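/- Let $m\ge 0$ and $n>1$ be integers. For a finite-dimensional Euclidean space $F$ (a real vector space with a scalar product), with group $O(F)$ of linear isometries $F\to F$, let $\mathrm{Hom}_{O(F)}(F^{\otimes m},\mathbb{R})$ denote the vector space of linear forms $\omega\colon F\otimes\stackrel{m}{\cdots}\otimes F\to\mathbb{R}$ that are invariant under the diagonal action of $O(F)$; that is, $\omega(g^{\otimes m}t)=\omega(t)$ for all $g\in O(F)$ and $t\in F^{\otimes m}$. Let $E$ be a Euclidean space of dimension $n-1$, and let $E\perp\mathbb{R}$ be the $n$-dimensional Euclidean space given by the orthogonal sum of $E$ and $\mathbb{R}$ (with its standard scalar product). Restriction along the inclusion $i\colon E\hookrightarrow E\perp\mathbb{R}$, $x\mapsto(x,0)$, defines the dimensional reduction linear map $$ r_n\colon \mathrm{Hom}_{O(E\perp\mathbb{R})}\big((E\perp\mathbb{R})^{\otimes m},\mathbb{R}\big)\longrightarrow \mathrm{Hom}_{O(E)}\big(E^{\otimes m},\mathbb{R}\big),\qquad r_n(\omega)=\omega\circ i^{\otimes m}. $$ Then $r_n$ is surjective for every $n>1$, and $r_n$ is a linear isomorphism whenever moreover $n>m-1$.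 -/

import Mathlib

open scoped TensorProduct

noncomputable section

/-- The space of linear forms `E ⊗ ⋯ ⊗ E → ℝ` (`m` factors) on a Euclidean space `E` which are
invariant under the diagonal action of the orthogonal group of linear isometries of `E`. -/
def invariantForms (m : ℕ) (E : Type*) [NormedAddCommGroup E] [InnerProductSpace ℝ E] :
    Submodule ℝ (Module.Dual ℝ (⨂[ℝ]^m E)) where
  carrier := {ω | ∀ (g : E ≃ₗᵢ[ℝ] E) (t : ⨂[ℝ]^m E),
    ω (PiTensorProduct.map (fun _ => g.toLinearEquiv.toLinearMap) t) = ω t}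
  add_mem' := fun h₁ h₂ g t => by
    rw [LinearMap.add_apply, LinearMap.add_apply, h₁ g t, h₂ g t]
  zero_mem' := fun _ _ => rfl
  smul_mem' := fun c _ h g t => by
    rw [LinearMap.smul_apply, LinearMap.smul_apply, h g t]

/-- The orthogonal sum `E ⊥ ℝ`: the product `E × ℝ` with the inner product
`⟪(x, s), (y, t)⟫ = ⟪x, y⟫ + s t`. -/
abbrev OrthSumReal (E : Type*) : Type _ := WithLp 2 (E × ℝ)

/-- The inclusion `E ↪ E ⊥ ℝ`, `x ↦ (x, 0)`. -/
def inclOrthSum (E : Type*) [NormedAddCommGroup E] [InnerProductSpace ℝ E] :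
    E →ₗ[ℝ] OrthSumReal E :=
  (WithLp.linearEquiv 2 ℝ (E × ℝ)).symm.toLinearMap ∘ₗ LinearMap.inl ℝ E ℝ

/-- The extension of an isometry `g` of `E` to the isometry `g ⊥ id` of `E ⊥ ℝ`. -/
def extendIsometry {E : Type*} [NormedAddCommGroup E] [InnerProductSpace ℝ E]
    (g : E ≃ₗᵢ[ℝ] E) : OrthSumReal E ≃ₗᵢ[ℝ] OrthSumReal E where
  toLinearEquiv := (WithLp.linearEquiv 2 ℝ (E × ℝ)).trans
    ((g.toLinearEquiv.prodCongr (LinearEquiv.refl ℝ ℝ)).trans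
      (WithLp.linearEquiv 2 ℝ (E × ℝ)).symm)
  norm_map' := fun x => by
    simp [WithLp.prod_norm_eq_of_L2]

theorem extendIsometry_comp_incl {E : Type*} [NormedAddCommGroup E] [InnerProductSpace ℝ E]
    (g : E ≃ₗᵢ[ℝ] E) :
    (extendIsometry g).toLinearEquiv.toLinearMap ∘ₗ inclOrthSum E =
      inclOrthSum E ∘ₗ g.toLinearEquiv.toLinearMap := by
  ext x <;> simp [extendIsometry, inclOrthSum]

/-- The dimensional reduction: an invariant form `ω` on `E ⊥ ℝ` is sent to the composition
`E ⊗ ⋯ ⊗ E → (E ⊥ ℝ) ⊗ ⋯ ⊗ (E ⊥ ℝ) → ℝ` of the map induced by the inclusion with `ω`. -/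
def dimReduction (m : ℕ) (E : Type*) [NormedAddCommGroup E] [InnerProductSpace ℝ E] :
    invariantForms m (OrthSumReal E) →ₗ[ℝ] invariantForms m E where
  toFun ω := ⟨ω.1 ∘ₗ PiTensorProduct.map (fun _ => inclOrthSum E), fun g t => by
    refine Eq.trans (congrArg ω.1 ?_)
      (ω.2 (extendIsometry g) (PiTensorProduct.map (fun _ => inclOrthSum E) t))
    rw [← LinearMap.comp_apply, ← LinearMap.comp_apply, ← PiTensorProduct.map_comp,
      ← PiTensorProduct.map_comp, extendIsometry_comp_incl]⟩
  map_add' _ _ := rfl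
  map_smul' _ _ := rfl

end

/-! Surjectivity is proved by induction on the number of slots, without classifying invariants. Let
d = dim E. Differentiating invariance along plane rotations and summing over a basis
(`IsInvariant.casimir`) shows that (d - 1)ω + ∑_{j ≠ i} (i j)ω is a sum of products of a scalar
product with a contraction of ω. Contractions are invariant forms in two fewer slots, so they extend
by induction, and so do these products.

It remains to extend ω itself. Suppose ω alternates on a set T of slots;
`mem_extendable_of_alternatesOn` argues by descending induction on |T|. For l outside T, ω - ∑_{j ∈
T} (j l)ω alternates on T ∪ {l}, hence extends. Adding these to the Casimir relations for i in T
cancels all transpositions and leaves (|Tᶜ| + |T|(d - |T|))ω. Where this coefficient is not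
positive, ω vanishes.

Injectivity is a check on basis vectors: with at most d + 1 slots, either a vector occurs exactly
once and a reflection kills the value, or a vector is missing and an isometry moves the family into
E. -/

namespace OrthInvariant

open Function InnerProductSpace

/-! ### Infinitesimal invariance and the Casimir identity -/

section

variable {ι : Type*} {E : Type*} [NormedAddCommGroup E] [InnerProductSpace ℝ E]

/-- A multilinear form on `E` which is invariant under all linear isometries of `E`. -/
def IsInvariant (ω : MultilinearMap ℝ (fun _ : ι => E) ℝ) : Prop :=
  ∀ (g : E ≃ₗᵢ[ℝ] E) (v : ι → E), ω (fun i => g (v i)) = ω v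

/-- A multilinear form on a finite-dimensional space is continuous. -/
theorem continuous_multilinear [Fintype ι] [FiniteDimensional ℝ E]
    (ω : MultilinearMap ℝ (fun _ : ι => E) ℝ) : Continuous ω := by
  classical
  have h : (ω : (ι → E) → ℝ) = fun v => ∑ r : ι → Fin (Module.finrank ℝ E),
      (∏ i, inner ℝ (stdOrthonormalBasis ℝ E (r i)) (v i)) *
        ω (fun i => stdOrthonormalBasis ℝ E (r i)) := by
    ext v
    conv_lhs => rw [show v = fun i => ∑ a, inner ℝ (stdOrthonormalBasis ℝ E a) (v i) •
      stdOrthonormalBasis ℝ E a from funext fun i => ((stdOrthonormalBasis ℝ E).sum_repr' _).symm]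
    rw [MultilinearMap.map_sum]
    simp_rw [MultilinearMap.map_smul_univ, smul_eq_mul]
  rw [h]
  fun_prop

/-- Skew operators annihilate an invariant form, acting as derivations. -/
theorem IsInvariant.sum_update_skew [Fintype ι] [DecidableEq ι] [FiniteDimensional ℝ E]
    {ω : MultilinearMap ℝ (fun _ : ι => E) ℝ} (hω : IsInvariant ω)
    {A : E →L[ℝ] E} (hA : A ∈ skewAdjoint (E →L[ℝ] E)) (v : ι → E) :
    ∑ k, ω (update v k (A (v k))) = 0 := by
  obtain ⟨f, hf⟩ : ∃ f : ContinuousMultilinearMap ℝ (fun _ : ι => E) ℝ, ∀ u, f u = ω u :=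
    ⟨⟨ω, continuous_multilinear ω⟩, fun _ => rfl⟩
  let : NormedAlgebra ℚ (E →L[ℝ] E) := NormedAlgebra.restrictScalars ℚ ℝ (E →L[ℝ] E)
  have hd (k : ι) : HasFDerivAt (fun t : ℝ => NormedSpace.exp (t • A) (v k))
      (ContinuousLinearMap.toSpanSingleton ℝ (A (v k))) 0 := by
    have h := (hasDerivAt_exp_smul_const (𝕂 := ℝ) A 0).clm_apply (hasDerivAt_const (0 : ℝ) (v k))
    simpa using h.hasFDerivAt
  have h₁ := (HasFDerivAt.multilinear_comp (f := f) hd).hasDerivAt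
  have hc : (fun t : ℝ => f fun k => NormedSpace.exp (t • A) (v k)) = fun _ => ω v := by
    funext t
    have hu : NormedSpace.exp (t • A) ∈ unitary (E →L[ℝ] E) :=
      NormedSpace.exp_mem_unitary_of_mem_skewAdjoint (skewAdjoint.smul_mem t hA)
    exact (hf _).trans <| hω (Unitary.linearIsometryEquiv ⟨_, hu⟩) v
  rw [hc] at h₁
  have h₂ := h₁.unique (hasDerivAt_const (0 : ℝ) (ω v))
  simpa [hf] using h₂

theorem IsInvariant.sum_update_rotation [Fintype ι] [DecidableEq ι] [FiniteDimensional ℝ E]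
    {ω : MultilinearMap ℝ (fun _ : ι => E) ℝ} (hω : IsInvariant ω) (x y : E) (v : ι → E) :
    ∑ k, ω (update v k (inner ℝ x (v k) • y - inner ℝ y (v k) • x)) = 0 := by
  have hA : rankOne ℝ y x - rankOne ℝ x y ∈ skewAdjoint (E →L[ℝ] E) := by
    rw [skewAdjoint.mem_iff, ContinuousLinearMap.star_eq_adjoint, map_sub, adjoint_rankOne,
      adjoint_rankOne, neg_sub]
  simpa using hω.sum_update_skew hA v

variable [Fintype ι] [DecidableEq ι] {κ : Type*} [Fintype κ]

/-- The contraction of the form `ω` in the slots `i` and `j`, as a function on all slots. -/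
noncomputable def contract (b : OrthonormalBasis κ ℝ E) (ω : MultilinearMap ℝ (fun _ : ι => E) ℝ)
    (i j : ι) (v : ι → E) : ℝ :=
  ∑ a, ω (update (update v i (b a)) j (b a))

/-- The action of the Casimir element of `𝔰𝔬(E)` on an invariant form, seen from the slot `i`. -/
theorem IsInvariant.casimir [FiniteDimensional ℝ E] (b : OrthonormalBasis κ ℝ E)
    {ω : MultilinearMap ℝ (fun _ : ι => E) ℝ} (hω : IsInvariant ω) (i : ι) (v : ι → E) :
    ((Fintype.card κ : ℝ) - 1) * ω v + ∑ j ∈ Finset.univ.erase i, ω (v ∘ Equiv.swap i j) =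
      ∑ j ∈ Finset.univ.erase i, inner ℝ (v i) (v j) * contract b ω i j v := by
  -- Rotation in the plane of `v i` and `b a`, applied after `b a` has been put into slot `i`; the
  -- sum over `a` gives the identity.
  have key (a : κ) : inner ℝ (v i) (b a) * ω (update v i (b a)) - ω v +
      ∑ j ∈ Finset.univ.erase i, (inner ℝ (v i) (v j) * ω (update (update v i (b a)) j (b a)) -
        inner ℝ (b a) (v j) * ω (update (update v i (b a)) j (v i))) = 0 := by
    have h := hω.sum_update_rotation (v i) (b a) (update v i (b a))
    rw [← Finset.add_sum_erase _ _ (Finset.mem_univ i)] at h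
    rw [← h]
    congr 1
    · simp [MultilinearMap.map_update_sub, MultilinearMap.map_update_smul, b.orthonormal.1 a]
    · refine Finset.sum_congr rfl fun j hj => ?_
      rw [update_of_ne (Finset.ne_of_mem_erase hj), MultilinearMap.map_update_sub,
        MultilinearMap.map_update_smul, MultilinearMap.map_update_smul, smul_eq_mul, smul_eq_mul]
  have expand (u : ι → E) (j : ι) (w : E) :
      ∑ a, inner ℝ (b a) w * ω (update u j (b a)) = ω (update u j w) := by
    conv_rhs => rw [← b.sum_repr' w, MultilinearMap.map_update_sum]
    simp_rw [MultilinearMap.map_update_smul, smul_eq_mul]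
  have h := Finset.sum_eq_zero fun a (_ : a ∈ Finset.univ) => key a
  rw [Finset.sum_add_distrib, Finset.sum_sub_distrib, Finset.sum_comm] at h
  simp_rw [Finset.sum_sub_distrib] at h
  have h₁ : ∑ a, inner ℝ (v i) (b a) * ω (update v i (b a)) = ω v := by
    simp_rw [fun a => real_inner_comm (b a) (v i)]
    rw [expand, update_eq_self]
  have h₂ : ∑ j ∈ Finset.univ.erase i, ∑ a,
      inner ℝ (b a) (v j) * ω (update (update v i (b a)) j (v i)) =
      ∑ j ∈ Finset.univ.erase i, ω (v ∘ Equiv.swap i j) := by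
    refine Finset.sum_congr rfl fun j hj => ?_
    have hji := Finset.ne_of_mem_erase hj
    simp_rw [fun a => update_comm hji.symm (b a) (v i) v]
    rw [expand, Equiv.comp_swap_eq_update]
  have h₃ : ∑ j ∈ Finset.univ.erase i, ∑ a,
      inner ℝ (v i) (v j) * ω (update (update v i (b a)) j (b a)) =
      ∑ j ∈ Finset.univ.erase i, inner ℝ (v i) (v j) * contract b ω i j v := by
    simp_rw [contract, Finset.mul_sum]
  rw [h₁, h₂, h₃, Finset.sum_const, Finset.card_univ, nsmul_eq_mul] at h
  linarith

end

/-! ### Extendable forms and contractions -/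

section

variable {ι : Type*} {E F : Type*} [NormedAddCommGroup E] [InnerProductSpace ℝ E]
  [NormedAddCommGroup F] [InnerProductSpace ℝ F]

/-- The form `ω` on `E` is the restriction along `φ` of an invariant form on `F`. -/
def IsExtendable (φ : E →ₗᵢ[ℝ] F) (ω : MultilinearMap ℝ (fun _ : ι => E) ℝ) : Prop :=
  ∃ Ω : MultilinearMap ℝ (fun _ : ι => F) ℝ, IsInvariant Ω ∧ ∀ v, Ω (fun i => φ (v i)) = ω v

/-- The forms that extend along `φ` to invariant forms. -/
def extendable (ι : Type*) (φ : E →ₗᵢ[ℝ] F) :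
    Submodule ℝ (MultilinearMap ℝ (fun _ : ι => E) ℝ) where
  carrier := {ω | IsExtendable φ ω}
  add_mem' := by
    rintro ω₁ ω₂ ⟨Ω₁, h₁, e₁⟩ ⟨Ω₂, h₂, e₂⟩
    exact ⟨Ω₁ + Ω₂, fun g v => by simp [h₁ g v, h₂ g v], fun v => by simp [e₁, e₂]⟩
  zero_mem' := ⟨0, fun _ _ => rfl, fun _ => rfl⟩
  smul_mem' := by
    rintro c ω ⟨Ω, h, e⟩
    exact ⟨c • Ω, fun g v => by simp [h g v], fun v => by simp [e]⟩

theorem restrict_update_of_not {α M : Type*} [DecidableEq α] {P : α → Prop} {c : α} (hc : ¬ P c)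
    (v : α → M) (x : M) : (fun k : {k // P k} => update v c x k) = fun k : {k // P k} => v k := by
  funext k
  refine update_of_ne ?_ _ _
  rintro rfl
  exact hc k.2

theorem restrict_update {α M : Type*} [DecidableEq α] {P : α → Prop} {c : α} (hc : P c)
    (v : α → M) (x : M) : (fun k : {k // P k} => update v c x k) =
      update (fun k : {k // P k} => v k) ⟨c, hc⟩ x := by
  funext k
  by_cases h : k = ⟨c, hc⟩
  · subst h; simp
  · rw [update_of_ne h, update_of_ne fun h' => h (Subtype.ext h')]

/-- The product of the scalar product of the slots `i` and `j` with a form in the other slots. -/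
noncomputable def mulInner {i j : ι} (hij : i ≠ j)
    (η : MultilinearMap ℝ (fun _ : {k // k ≠ i ∧ k ≠ j} => E) ℝ) :
    MultilinearMap ℝ (fun _ : ι => E) ℝ where
  toFun v := inner ℝ (v i) (v j) * η (fun k => v k)
  map_update_add' v c x y := by
    by_cases hi : c = i
    · subst hi
      simp_rw [restrict_update_of_not (P := fun k => k ≠ c ∧ k ≠ j) (fun h => h.1 rfl)]
      simp [hij.symm, inner_add_left, add_mul]
    by_cases hj : c = j
    · subst hj
      simp_rw [restrict_update_of_not (P := fun k => k ≠ i ∧ k ≠ c) (fun h => h.2 rfl)]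
      simp [hij, inner_add_right, add_mul]
    simp_rw [restrict_update (P := fun k => k ≠ i ∧ k ≠ j) ⟨hi, hj⟩]
    simp [Ne.symm hi, Ne.symm hj, mul_add]
  map_update_smul' v c r x := by
    by_cases hi : c = i
    · subst hi
      simp_rw [restrict_update_of_not (P := fun k => k ≠ c ∧ k ≠ j) (fun h => h.1 rfl)]
      simp [hij.symm, inner_smul_left, mul_assoc]
    by_cases hj : c = j
    · subst hj
      simp_rw [restrict_update_of_not (P := fun k => k ≠ i ∧ k ≠ c) (fun h => h.2 rfl)]
      simp [hij, inner_smul_right, mul_assoc]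
    simp_rw [restrict_update (P := fun k => k ≠ i ∧ k ≠ j) ⟨hi, hj⟩]
    simp [Ne.symm hi, Ne.symm hj, mul_left_comm]

theorem mulInner_apply {i j : ι} (hij : i ≠ j)
    (η : MultilinearMap ℝ (fun _ : {k // k ≠ i ∧ k ≠ j} => E) ℝ) (v : ι → E) :
    mulInner hij η v = inner ℝ (v i) (v j) * η (fun k => v k) := rfl

theorem mulInner_mem_extendable {φ : E →ₗᵢ[ℝ] F} {i j : ι} (hij : i ≠ j)
    {η : MultilinearMap ℝ (fun _ : {k // k ≠ i ∧ k ≠ j} => E) ℝ} (hη : η ∈ extendable _ φ) :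
    mulInner hij η ∈ extendable ι φ := by
  obtain ⟨H, hH, e⟩ := hη
  refine ⟨mulInner hij H, fun g v => ?_, fun v => ?_⟩
  · rw [mulInner_apply, mulInner_apply, g.inner_map_map, hH g]
  · rw [mulInner_apply, mulInner_apply, φ.inner_map_map, ← e]

variable {κ : Type*} [Fintype κ] [DecidableEq ι]

/-- The contraction of the form `ω` in the slots `i` and `j`, as a form in the other slots. -/
noncomputable def contractForm (b : OrthonormalBasis κ ℝ E)
    (ω : MultilinearMap ℝ (fun _ : ι => E) ℝ) (i j : ι) :
    MultilinearMap ℝ (fun _ : {k // k ≠ i ∧ k ≠ j} => E) ℝ :=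
  ∑ a, ω.domDomRestrict (fun k => k ≠ i ∧ k ≠ j) (fun _ => b a)

theorem contractForm_restrict (b : OrthonormalBasis κ ℝ E)
    (ω : MultilinearMap ℝ (fun _ : ι => E) ℝ) (i j : ι) (v : ι → E) :
    contractForm b ω i j (fun k => v k) = contract b ω i j v := by
  rw [contractForm, contract, sum_apply]
  refine Finset.sum_congr rfl fun a _ => ?_
  rw [MultilinearMap.domDomRestrict_apply]
  congr 1
  funext k
  simp only [update_apply]
  grind

/-- A contraction does not depend on the orthonormal basis. -/
theorem contract_eq_contract (b b' : OrthonormalBasis κ ℝ E)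
    (ω : MultilinearMap ℝ (fun _ : ι => E) ℝ) {i j : ι} (hij : i ≠ j) (v : ι → E) :
    contract b ω i j v = contract b' ω i j v := by
  let B : E →ₗ[ℝ] E →ₗ[ℝ] ℝ := LinearMap.mk₂ ℝ (fun x y => ω (update (update v i x) j y))
    (fun x x' y => by simp_rw [update_comm hij, MultilinearMap.map_update_add])
    (fun c x y => by simp_rw [update_comm hij, MultilinearMap.map_update_smul])
    (fun x y y' => by simp_rw [MultilinearMap.map_update_add])
    (fun c x y => by simp_rw [MultilinearMap.map_update_smul])
  -- The operator representing `B`, so that B(x, x) = ⟪x, T x⟫ and the contraction is a trace.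
  let T : E →ₗ[ℝ] E := ∑ c, (B.flip (b c)).smulRight (b c)
  have hT (e : OrthonormalBasis κ ℝ E) : contract e ω i j v = LinearMap.trace ℝ E T := by
    rw [LinearMap.trace_eq_sum_inner T e]
    refine Finset.sum_congr rfl fun a _ => ?_
    have h : B (e a) (e a) = inner ℝ (e a) (T (e a)) := by
      have hL (L : E →ₗ[ℝ] ℝ) (x : E) : L x = ∑ c, inner ℝ (b c) x * L (b c) := by
        conv_lhs => rw [← b.sum_repr' x, map_sum]
        simp
      rw [hL (B (e a))]
      simp [T, inner_sum, inner_smul_right, mul_comm, real_inner_comm]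
    exact h
  rw [hT b, hT b']

theorem contract_comp_isometry (b : OrthonormalBasis κ ℝ E)
    {ω : MultilinearMap ℝ (fun _ : ι => E) ℝ} (hω : IsInvariant ω) {i j : ι} (hij : i ≠ j)
    (g : E ≃ₗᵢ[ℝ] E) (v : ι → E) :
    contract b ω i j (fun k => g (v k)) = contract b ω i j v := by
  rw [contract_eq_contract b (b.map g) ω hij]
  refine Finset.sum_congr rfl fun a _ => ?_
  rw [← hω g (update (update v i (b a)) j (b a))]
  congr 1
  funext k
  simp only [update_apply, b.map_apply]
  split_ifs <;> rfl

theorem IsInvariant.contractForm (b : OrthonormalBasis κ ℝ E)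
    {ω : MultilinearMap ℝ (fun _ : ι => E) ℝ} (hω : IsInvariant ω) {i j : ι} (hij : i ≠ j) :
    IsInvariant (contractForm b ω i j) := by
  intro g w
  obtain ⟨v, rfl⟩ : ∃ v : ι → E, w = fun k : {k // k ≠ i ∧ k ≠ j} => v k := by
    refine ⟨fun l => if h : l ≠ i ∧ l ≠ j then w ⟨l, h⟩ else 0, ?_⟩
    funext k
    simp [k.2.1, k.2.2]
  rw [contractForm_restrict b ω i j, ← contract_comp_isometry b hω hij g]
  exact contractForm_restrict b ω i j fun k => g (v k)

theorem casimir_mem_extendable [Fintype ι] [FiniteDimensional ℝ E] {φ : E →ₗᵢ[ℝ] F}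
    (b : OrthonormalBasis κ ℝ E)
    {ω : MultilinearMap ℝ (fun _ : ι => E) ℝ} (hω : IsInvariant ω) (i : ι)
    (ih : ∀ j ≠ i, contractForm b ω i j ∈ extendable _ φ) :
    ((Fintype.card κ : ℝ) - 1) • ω +
      ∑ j ∈ Finset.univ.erase i, ω.domDomCongr (Equiv.swap i j) ∈ extendable ι φ := by
  have h : ((Fintype.card κ : ℝ) - 1) • ω +
      ∑ j ∈ Finset.univ.erase i, ω.domDomCongr (Equiv.swap i j) =
      ∑ j : {j // j ∈ Finset.univ.erase i},
        mulInner (Finset.ne_of_mem_erase j.2).symm (contractForm b ω i j) := by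
    ext v
    rw [sum_apply]
    simp_rw [mulInner_apply, contractForm_restrict b ω i]
    rw [Finset.univ_eq_attach, Finset.sum_attach _ fun j => inner ℝ (v i) (v j) * contract b ω i j v,
      ← hω.casimir b i v]
    simp only [add_apply, smul_apply, sum_apply, MultilinearMap.domDomCongr_apply, smul_eq_mul]
    rfl
  rw [h]
  exact Submodule.sum_mem _ fun j _ => mulInner_mem_extendable _ (ih j (Finset.ne_of_mem_erase j.2))

end

/-! ### Partially alternating forms and surjectivity -/

section

variable {ι : Type*} {E F : Type*} [NormedAddCommGroup E] [InnerProductSpace ℝ E]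
  [NormedAddCommGroup F] [InnerProductSpace ℝ F] {κ : Type*} [Fintype κ]

/-- An invariant form vanishes on a family of basis vectors in which one of them occurs exactly
once. -/
theorem IsInvariant.apply_basis_eq_zero (b : OrthonormalBasis κ ℝ E)
    {ω : MultilinearMap ℝ (fun _ : ι => E) ℝ} (hω : IsInvariant ω) (f : ι → κ) (i : ι)
    (hf : ∀ j ≠ i, f j ≠ f i) : ω (fun j => b (f j)) = 0 := by
  classical
  -- This reflection negates `b (f i)` and fixes the other vectors, so the value equals its own
  -- negative.
  have h := hω (ℝ ∙ b (f i))ᗮ.reflection fun j => b (f j)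
  have e : (fun j => (ℝ ∙ b (f i))ᗮ.reflection (b (f j))) =
      update (fun j => b (f j)) i ((-1 : ℝ) • b (f i)) := by
    funext j
    by_cases hj : j = i
    · subst hj
      rw [update_self, Submodule.reflection_orthogonalComplement_singleton_eq_neg, neg_one_smul]
    · rw [update_of_ne hj]
      apply Submodule.reflection_mem_subspace_eq_self
      rw [Submodule.mem_orthogonal_singleton_iff_inner_left]
      exact b.orthonormal.2 (hf j hj)
  rw [e, MultilinearMap.map_update_smul, update_eq_self i fun j => b (f j), neg_one_smul] at h
  linarith

theorem IsInvariant.domDomCongr {ω : MultilinearMap ℝ (fun _ : ι => E) ℝ} (hω : IsInvariant ω)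
    (σ : Equiv.Perm ι) : IsInvariant (ω.domDomCongr σ) :=
  fun g v => hω g fun i => v (σ i)

variable [DecidableEq ι]

/-- The form `ω` changes sign under the transpositions of the slots in `T`. -/
def AlternatesOn (T : Finset ι) (ω : MultilinearMap ℝ (fun _ : ι => E) ℝ) : Prop :=
  ∀ i ∈ T, ∀ j ∈ T, i ≠ j → ∀ v, ω (v ∘ Equiv.swap i j) = -ω v

theorem AlternatesOn.apply_eq_zero {T : Finset ι} {ω : MultilinearMap ℝ (fun _ : ι => E) ℝ}
    (h : AlternatesOn T ω) {i j : ι} (hi : i ∈ T) (hj : j ∈ T) (hij : i ≠ j) {v : ι → E}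
    (hv : v i = v j) : ω v = 0 := by
  have h' := h i hi j hj hij v
  rw [Equiv.comp_swap_eq_update, hv, update_eq_self, ← hv, update_eq_self] at h'
  linarith

theorem AlternatesOn.eq_zero [Finite ι] {T : Finset ι} (b : OrthonormalBasis κ ℝ E)
    {ω : MultilinearMap ℝ (fun _ : ι => E) ℝ} (h : AlternatesOn T ω)
    (hT : Fintype.card κ < T.card) : ω = 0 := by
  refine Module.Basis.ext_multilinear (fun _ => b.toBasis) fun f => ?_
  obtain ⟨i, hi, j, hj, hij, hf⟩ := Finset.exists_ne_map_eq_of_card_lt_of_maps_to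
    (t := Finset.univ) hT (f := f) fun _ _ => Finset.mem_coe.2 (Finset.mem_univ _)
  exact h.apply_eq_zero hi hj hij (by rw [hf])

theorem AlternatesOn.eq_zero_of_isInvariant [Fintype ι] [Nonempty ι] (b : OrthonormalBasis κ ℝ E)
    {ω : MultilinearMap ℝ (fun _ : ι => E) ℝ} (h : AlternatesOn Finset.univ ω)
    (hω : IsInvariant ω) : ω = 0 := by
  refine Module.Basis.ext_multilinear (fun _ => b.toBasis) fun f => ?_
  simp only [OrthonormalBasis.coe_toBasis]
  by_cases hf : Injective f
  · exact hω.apply_basis_eq_zero b f (Classical.arbitrary ι) fun j hj => hf.ne hj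
  · obtain ⟨i, j, hij, hne⟩ := not_injective_iff.1 hf
    exact h.apply_eq_zero (Finset.mem_univ i) (Finset.mem_univ j) hne (by rw [hij])

/-- The identity and the transpositions `(j l)` represent the cosets of Sym(T) in Sym(T ∪ {l}), so
their signed sum completes the antisymmetrization. -/
theorem AlternatesOn.insert {T : Finset ι} {ω : MultilinearMap ℝ (fun _ : ι => E) ℝ}
    (h : AlternatesOn T ω) {l : ι} (hl : l ∉ T) :
    AlternatesOn (insert l T) (ω - ∑ j ∈ T, ω.domDomCongr (Equiv.swap j l)) := by
  have apply (v : ι → E) : (ω - ∑ j ∈ T, ω.domDomCongr (Equiv.swap j l)) v =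
      ω v - ∑ j ∈ T, ω (v ∘ Equiv.swap j l) := by
    simp only [sub_apply, sum_apply, MultilinearMap.domDomCongr_apply]
    rfl
  have h₁ (a : ι) (ha : a ∈ T) (v : ι → E) :
      (ω - ∑ j ∈ T, ω.domDomCongr (Equiv.swap j l)) (v ∘ Equiv.swap a l) =
        -(ω - ∑ j ∈ T, ω.domDomCongr (Equiv.swap j l)) v := by
    rw [apply, apply, ← Finset.add_sum_erase _ _ ha, ← Finset.add_sum_erase _ _ ha]
    have h₂ : ∑ j ∈ T.erase a, ω ((v ∘ Equiv.swap a l) ∘ Equiv.swap j l) =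
        ∑ j ∈ T.erase a, -ω (v ∘ Equiv.swap j l) := by
      refine Finset.sum_congr rfl fun j hj => ?_
      rw [Finset.mem_erase] at hj
      rw [← h j hj.2 a ha hj.1]
      congr 1
      funext x
      simp only [comp_apply, Equiv.swap_apply_def]
      grind
    rw [h₂, Finset.sum_neg_distrib, comp_assoc, ← Equiv.Perm.coe_mul, Equiv.swap_mul_self]
    simp
    ring
  intro i hi j hj hij v
  rw [Finset.mem_insert] at hi hj
  rcases hi with rfl | hi
  · rw [Equiv.swap_comm]
    exact h₁ j (hj.resolve_left hij.symm) v
  rcases hj with rfl | hj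
  · exact h₁ i hi v
  rw [apply, apply, h i hi j hj hij]
  have h₂ : ∑ a ∈ T, ω ((v ∘ Equiv.swap i j) ∘ Equiv.swap a l) =
      ∑ a ∈ T, -ω (v ∘ Equiv.swap a l) := by
    refine Finset.sum_equiv (Equiv.swap i j) (fun a => ?_) fun a ha => ?_
    · simp only [Equiv.swap_apply_def]
      grind
    · rw [← h i hi j hj hij]
      congr 1
      funext x
      simp only [comp_apply, Equiv.swap_apply_def]
      grind
  rw [h₂, Finset.sum_neg_distrib]
  ring

theorem mem_extendable_of_alternatesOn [Fintype ι] [Nonempty ι] [FiniteDimensional ℝ E]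
    {φ : E →ₗᵢ[ℝ] F} (b : OrthonormalBasis κ ℝ E)
    (ih : ∀ i j : ι, i ≠ j → ∀ η : MultilinearMap ℝ (fun _ : {k // k ≠ i ∧ k ≠ j} => E) ℝ,
      IsInvariant η → η ∈ extendable _ φ) (r : ℕ) :
    ∀ (T : Finset ι) (ω : MultilinearMap ℝ (fun _ : ι => E) ℝ),
      Fintype.card κ + 1 ≤ T.card + r → IsInvariant ω → AlternatesOn T ω →
        ω ∈ extendable ι φ := by
  induction r with
  | zero =>
    intro T ω hT _ h
    rw [h.eq_zero b (by omega)]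
    exact Submodule.zero_mem _
  | succ r ihr =>
    intro T ω hT hω h
    by_cases hk : Fintype.card κ < T.card
    · rw [h.eq_zero b hk]
      exact Submodule.zero_mem _
    -- The only remaining case in which the final coefficient vanishes.
    by_cases hu : T = Finset.univ ∧ T.card = Fintype.card κ
    · rw [AlternatesOn.eq_zero_of_isInvariant b (hu.1 ▸ h) hω]
      exact Submodule.zero_mem _
    have hB (l : ι) (hl : l ∈ Tᶜ) :
        ω - ∑ j ∈ T, ω.domDomCongr (Equiv.swap j l) ∈ extendable ι φ := by
      rw [Finset.mem_compl] at hl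
      refine ihr (insert l T) _ (by rw [Finset.card_insert_of_notMem hl]; omega) (fun g v => ?_)
        (h.insert hl)
      simp only [sub_apply, sum_apply, hω g v, hω.domDomCongr _ g v]
    -- Each of the |T| - 1 transpositions inside `T` contributes -ω, turning d - 1 into d - |T|.
    have hC (i : ι) (hi : i ∈ T) : ((Fintype.card κ : ℝ) - T.card) • ω +
        ∑ l ∈ Tᶜ, ω.domDomCongr (Equiv.swap i l) ∈ extendable ι φ := by
      convert! casimir_mem_extendable b hω i fun j hj =>
        ih i j hj.symm _ (hω.contractForm b hj.symm) using 1
      have hs : Finset.univ.erase i = T.erase i ∪ Tᶜ := by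
        ext x
        simp only [Finset.mem_erase, Finset.mem_univ, Finset.mem_union, Finset.mem_compl]
        grind
      have hneg : ∑ j ∈ T.erase i, ω.domDomCongr (Equiv.swap i j) = ∑ j ∈ T.erase i, -ω := by
        refine Finset.sum_congr rfl fun j hj => ?_
        ext v
        exact h i hi j (Finset.mem_of_mem_erase hj) (Finset.ne_of_mem_erase hj).symm v
      rw [hs, Finset.sum_union, hneg, Finset.sum_const, Finset.card_erase_of_mem hi, smul_neg,
        ← Nat.cast_smul_eq_nsmul ℝ, Nat.cast_pred (Finset.card_pos.2 ⟨i, hi⟩)]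
      · module
      · rw [Finset.disjoint_left]
        intro x hx hx'
        exact Finset.mem_compl.1 hx' (Finset.mem_of_mem_erase hx)
    have hsum := Submodule.add_mem _ (Submodule.sum_mem _ hB) (Submodule.sum_mem _ hC)
    rw [Finset.sum_sub_distrib, Finset.sum_add_distrib, Finset.sum_comm (s := T), Finset.sum_const,
      Finset.sum_const, ← Nat.cast_smul_eq_nsmul ℝ, ← Nat.cast_smul_eq_nsmul ℝ] at hsum
    have hc : (((Tᶜ.card + T.card * (Fintype.card κ - T.card) : ℕ) : ℝ)) • ω ∈ extendable ι φ := by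
      convert! hsum using 1
      push_cast [Nat.cast_sub (not_lt.1 hk)]
      module
    refine (Submodule.smul_mem_iff _ ?_).1 hc
    rw [Nat.cast_ne_zero]
    intro h0
    rw [Nat.add_eq_zero_iff, Finset.card_eq_zero, Finset.compl_eq_empty_iff, Nat.mul_eq_zero] at h0
    obtain ⟨hT', h0 | h0⟩ := h0
    · rw [Finset.card_eq_zero, hT'] at h0
      exact Finset.univ_nonempty.ne_empty h0
    · exact hu ⟨hT', by omega⟩

/-- Every invariant form on a finite-dimensional Euclidean space is the restriction of an invariant
form, along any isometric embedding. -/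
theorem IsInvariant.mem_extendable [FiniteDimensional ℝ E] (φ : E →ₗᵢ[ℝ] F) (m : ℕ) :
    ∀ (ι : Type) [Fintype ι] (ω : MultilinearMap ℝ (fun _ : ι => E) ℝ),
      Fintype.card ι = m → IsInvariant ω → ω ∈ extendable ι φ := by
  classical
  induction m using Nat.strong_induction_on with
  | _ m ihm =>
    intro ι _ ω hm hω
    cases isEmpty_or_nonempty ι with
    | inl h =>
      exact ⟨MultilinearMap.constOfIsEmpty ℝ _ (ω 0), fun _ _ => rfl,
        fun v => congrArg ω (Subsingleton.elim _ _)⟩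
    | inr h =>
      refine mem_extendable_of_alternatesOn (stdOrthonormalBasis ℝ E) (fun i j hij η hη => ?_) _
        ∅ ω (Nat.le_add_left _ _) hω fun i hi => absurd hi (Finset.notMem_empty i)
      refine ihm _ ?_ _ η rfl hη
      rw [← hm]
      exact Fintype.card_subtype_lt (x := i) fun h => h.1 rfl

end

/-! ### Passage to tensor powers, and injectivity -/

section

variable {E F : Type*} [NormedAddCommGroup E] [InnerProductSpace ℝ E]
  [NormedAddCommGroup F] [InnerProductSpace ℝ F] {κ : Type*} [Fintype κ] {m : ℕ}

theorem isInvariant_of_mem_invariantForms {W : Module.Dual ℝ (⨂[ℝ]^m E)}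
    (hW : W ∈ invariantForms m E) :
    IsInvariant (W.compMultilinearMap (PiTensorProduct.tprod ℝ)) := fun g v => by
  have h := hW g (PiTensorProduct.tprod ℝ v)
  rwa [PiTensorProduct.map_tprod] at h

theorem lift_mem_invariantForms {Ω : MultilinearMap ℝ (fun _ : Fin m => E) ℝ}
    (hΩ : IsInvariant Ω) : PiTensorProduct.lift Ω ∈ invariantForms m E := by
  intro g t
  rw [← LinearMap.comp_apply]
  congr 1
  refine PiTensorProduct.ext (MultilinearMap.ext fun v => ?_)
  simpa using hΩ g v

/-- The isometric embedding of `E` into the orthogonal sum of `E` and `ℝ`. -/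
noncomputable def inclIsometry (E : Type*) [NormedAddCommGroup E] [InnerProductSpace ℝ E] :
    E →ₗᵢ[ℝ] OrthSumReal E where
  toLinearMap := inclOrthSum E
  norm_map' x := by simp [inclOrthSum]

theorem dimReduction_surjective [FiniteDimensional ℝ E] :
    Surjective (dimReduction m E) := by
  intro W
  obtain ⟨Ω, hΩ, e⟩ := (isInvariant_of_mem_invariantForms W.2).mem_extendable (inclIsometry E) m
    (Fin m) _ (Fintype.card_fin m)
  refine ⟨⟨PiTensorProduct.lift Ω, lift_mem_invariantForms hΩ⟩, Subtype.ext ?_⟩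
  refine PiTensorProduct.ext (MultilinearMap.ext fun v => ?_)
  change PiTensorProduct.lift Ω (PiTensorProduct.map (fun _ => inclOrthSum E)
    (PiTensorProduct.tprod ℝ v)) = W.1 (PiTensorProduct.tprod ℝ v)
  rw [PiTensorProduct.map_tprod, PiTensorProduct.lift.tprod]
  exact e v

/-- An invariant form on `E ⊥ ℝ` in at most `dim E + 1` vectors vanishes if it vanishes on `E`. -/
theorem IsInvariant.eq_zero_of_comp_incl_eq_zero (b : OrthonormalBasis κ ℝ E)
    (hm : m ≤ Fintype.card κ + 1) {Ω : MultilinearMap ℝ (fun _ : Fin m => OrthSumReal E) ℝ}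
    (hΩ : IsInvariant Ω) (h : ∀ v : Fin m → E, Ω (fun i => inclOrthSum E (v i)) = 0) : Ω = 0 := by
  classical
  let B : OrthonormalBasis (κ ⊕ Unit) ℝ (OrthSumReal E) :=
    b.prod (OrthonormalBasis.singleton Unit ℝ)
  have hB (c : κ) : B (Sum.inl c) = inclOrthSum E (b c) := by
    simp [B, inclOrthSum]
  refine Module.Basis.ext_multilinear (fun _ => B.toBasis) fun f => ?_
  simp only [OrthonormalBasis.coe_toBasis]
  by_cases hf : Surjective f
  -- Here `hm` is needed: it makes every basis vector occur exactly once.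
  · have hb : Bijective f := (Fintype.bijective_iff_surjective_and_card f).2 ⟨hf, by
      have := Fintype.card_le_of_surjective f hf
      simp only [Fintype.card_fin, Fintype.card_sum, Fintype.card_unit] at this ⊢
      omega⟩
    obtain ⟨i, -⟩ := hf (Sum.inr ())
    exact hΩ.apply_basis_eq_zero B f i fun j hj => hb.1.ne hj
  -- Exchanging the missing vector `c` with the added one is an isometry that carries the family
  -- into `E`.
  · obtain ⟨c, hc⟩ := not_forall.1 hf
    have hc' (i : Fin m) : ∃ a : κ, Equiv.swap c (Sum.inr ()) (f i) = Sum.inl a := by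
      cases h' : Equiv.swap c (Sum.inr ()) (f i) with
      | inl a => exact ⟨a, rfl⟩
      | inr u =>
        rw [Equiv.swap_apply_eq_iff, Equiv.swap_apply_right] at h'
        exact absurd ⟨i, h'⟩ hc
    choose a ha using hc'
    rw [← hΩ (B.equiv B (Equiv.swap c (Sum.inr ())))]
    simp_rw [OrthonormalBasis.equiv_apply_basis, ha, hB]
    exact h _

theorem dimReduction_injective [FiniteDimensional ℝ E] (hm : m ≤ Module.finrank ℝ E + 1) :
    Injective (dimReduction m E) := by
  rw [injective_iff_map_eq_zero]
  intro W hW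
  have h := (isInvariant_of_mem_invariantForms W.2).eq_zero_of_comp_incl_eq_zero
    (stdOrthonormalBasis ℝ E) (by simpa using hm) fun v => by
      have h' := LinearMap.congr_fun (congrArg Subtype.val hW) (PiTensorProduct.tprod ℝ v)
      change W.1 (PiTensorProduct.map (fun _ => inclOrthSum E)
        (PiTensorProduct.tprod ℝ v)) = 0 at h'
      rwa [PiTensorProduct.map_tprod] at h'
  exact Subtype.ext (PiTensorProduct.ext h)

end

end OrthInvariant

theorem mainTheorem5 (m n : ℕ) (hn : 1 < n)
    (E : Type*) [NormedAddCommGroup E] [InnerProductSpace ℝ E]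
    (hE : Module.finrank ℝ E = n - 1) :
    Function.Surjective (dimReduction m E) ∧
      ((m : ℤ) - 1 < (n : ℤ) → Function.Bijective (dimReduction m E)) := by
  have : FiniteDimensional ℝ E := FiniteDimensional.of_finrank_pos (by omega)
  exact ⟨OrthInvariant.dimReduction_surjective, fun hmn =>
    ⟨OrthInvariant.dimReduction_injective (by omega), OrthInvariant.dimReduction_surjective⟩⟩
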